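/- Let $d\ge 1$ be an integer, let $\mathbf c=(c_0,c_1,\dots,c_d)\in(0,\infty)^{d+1}$ satisfy $\sum_{i=1}^d c_i<1$, and let $\nu$ be a probability measure on $\mathbb R^d$ with $\int_{\mathbb R^d}|x|\,\nu(dx)<\infty$. Let $\mathcal M_0(\mathbf c)$ be the set of measurable functions $m:\mathbb R^d\to\mathbb R$ with $|m(x)|\le c_0+\sum_{i=1}^d c_i|x_i|$ for all $x\in\mathbb R^d$. For $m\in\mathcal M_0(\mathbf c)$ and an integer $T\geq 0$, consider the nonlinear AR($d$) model \[ Y_t=m(Y_{t-1},\dots,Y_{t-d})+v_t\quad(t=1,\dots,T),\qquad (Y_0,Y_{-1},\dots,Y_{-d+1})\sim\nu, \] where $v_1,\dots,v_T$ are i.i.d. $N(0,1)$ and independent of $(Y_0,\dots,Y_{-d+1})$. For sub-$\sigma$-fields $\mathcal A,\mathcal B$ of a probability space put \[ \beta(\mathcal A,\mathcal B)=\frac12\sup\sum_{i\in I}\sum_{j\in J}\left|P(A_i\cap B_j)-P(A_i)P(B_j)\right|, \] the supremum being over all finite partitions $\{A_i\}_{i\in I}\subset\mathcal A$ and $\{B_j\}_{j\in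 J}\subset\mathcal B$ of the space, and let \[ \beta_Y(t)=\sup_{1\le k\le T-t}\beta\bigl(\sigma(Y_1,\dots,Y_k),\,\sigma(Y_{k+t},\dots,Y_T)\bigr), \] with $\beta_Y(t)=0$ if $t\ge T$. Then there are constants $C_\beta>0$ and $C'_\beta>0$, depending only on $\mathbf c$, $d$ and $\nu$ (in particular, neither on $m$ nor on $T$), such that for every $m\in\mathcal M_0(\mathbf c)$, every $T$, and every such process $Y=\{Y_t\}_{t=1}^T$, \[ \beta_Y(t)\le C'_\beta e^{-C_\beta t}\qquad\text{for all integers }t\ge1 . \] -/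

import Mathlib

open MeasureTheory ProbabilityTheory
open scoped ENNReal

noncomputable section

/-- A finite family of sets that belong to the σ-field `𝒜` and partition the whole space. -/
structure IsFinitePartition {Ω : Type*} (𝒜 : MeasurableSpace Ω) {n : ℕ}
    (A : Fin n → Set Ω) : Prop where
  measurableSet : ∀ i, MeasurableSet[𝒜] (A i)
  disjoint : ∀ i j, i ≠ j → Disjoint (A i) (A j)
  iUnion_eq : ⋃ i, A i = Set.univ

/-- The β-mixing coefficient of two sub-σ-fields `𝒜`, `ℬ` of a probability space:
half of the supremum of `∑ i, ∑ j, |P(A i ∩ B j) - P(A i) P(B j)|` over all finite partitions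
`A` of the space into sets of `𝒜` and `B` into sets of `ℬ`.
It takes values in `[0, ∞]`, so that the supremum always exists. -/
def betaCoeff {Ω : Type*} {_ : MeasurableSpace Ω} (P : Measure Ω) (𝒜 ℬ : MeasurableSpace Ω) : ℝ≥0∞ :=
  2⁻¹ * ⨆ (n : ℕ) (k : ℕ) (A : Fin n → Set Ω) (B : Fin k → Set Ω)
    (_ : IsFinitePartition 𝒜 A) (_ : IsFinitePartition ℬ B),
    ENNReal.ofReal (∑ i, ∑ j, |P.real (A i ∩ B j) - P.real (A i) * P.real (B j)|)

/-- The σ-field generated by the variables `Y s` with `a ≤ s ≤ b`. -/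
abbrev sigmaField {Ω : Type*} (Y : ℤ → Ω → ℝ) (a b : ℤ) : MeasurableSpace Ω :=
  ⨆ s ∈ Set.Icc a b, MeasurableSpace.comap (Y s) (borel ℝ)

/-- The β-mixing coefficient at lag `t` of the process `Y 1, …, Y T`: the supremum over `k`
of the coefficient between `σ(Y 1, …, Y k)` and `σ(Y (k + t), …, Y T)`.
(For `k + t > T` the second σ-field would be trivial and the coefficient zero.) -/
def betaMixing {Ω : Type*} [MeasurableSpace Ω] (P : Measure Ω) (Y : ℤ → Ω → ℝ) (T t : ℕ) : ℝ≥0∞ :=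
  ⨆ (k : ℤ) (_ : 1 ≤ k ∧ k + t ≤ T), betaCoeff P (sigmaField Y 1 k) (sigmaField Y (k + t) T)

/-- The vector `(Y (t - 1), Y (t - 2), …, Y (t - d))`. -/
def lagVector {Ω : Type*} (d : ℕ) (Y : ℤ → Ω → ℝ) (t : ℤ) (ω : Ω) : Fin d → ℝ :=
  fun i => Y (t - 1 - (i : ℕ)) ω

/-- `Y` (at the times `1 - d, …, T`) follows the nonlinear AR(`d`) model with regression function
`m`, initial law `ν` and innovations `v 1, …, v T`, on the probability space `(Ω, P)`. -/
structure IsNonlinearAR {Ω : Type*} [MeasurableSpace Ω] (P : Measure Ω) (d T : ℕ)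
    (ν : Measure (Fin d → ℝ)) (m : (Fin d → ℝ) → ℝ) (Y v : ℤ → Ω → ℝ) : Prop where
  measurable_Y : ∀ t ∈ Set.Icc (1 - (d : ℤ)) T, Measurable (Y t)
  measurable_v : ∀ t ∈ Set.Icc (1 : ℤ) T, Measurable (v t)
  recursion : ∀ t ∈ Set.Icc (1 : ℤ) T, ∀ᵐ ω ∂P, Y t ω = m (lagVector d Y t ω) + v t ω
  /-- the law of `(Y 0, Y (-1), …, Y (1 - d))` is `ν` -/
  law_init : P.map (lagVector d Y 1) = ν
  law_v : ∀ t ∈ Set.Icc (1 : ℤ) T, P.map (v t) = gaussianReal 0 1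
  iIndepFun_v : iIndepFun (fun t : Set.Icc (1 : ℤ) T => v t) P
  indepFun_init : IndepFun (lagVector d Y 1) (fun ω (t : Set.Icc (1 : ℤ) T) => v t ω) P

/-- The class of measurable `m : ℝᵈ → ℝ` with `|m x| ≤ c₀ + ∑ᵢ cᵢ |xᵢ|` for all `x`, where
`c = (c₀, c₁, …, c_d)`. -/
def regressionClass {d : ℕ} (c : Fin (d + 1) → ℝ) : Set ((Fin d → ℝ) → ℝ) :=
  {m | Measurable m ∧ ∀ x, |m x| ≤ c 0 + ∑ i : Fin d, c i.succ * |x i|}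

end

/-!
The vectors of the last `d` values form a Markov chain on `ℝᵈ` with a kernel `κ` depending only on
`m`. Since `c₁ + ⋯ + c_d < 1`, a weighted `ℓ¹` norm `V` is a Lyapunov function of `κ`; after `d`
steps a starting point in a ball is forgotten up to a bounded shift of the noise, so `κ ^ d` has a
minorant on that ball. By Harris' theorem `κ ^ d` contracts oscillations measured with a weight
`U = 1 + β V`, and all constants serve every `m` in the class. By the Markov property the conditional
mean of a function `f` of `Y (k + t), …, Y T` given the values up to time `k` is `κ ^ t g` at the
current state, with `g` the conditional mean of `f` given the state at time `k + t`. As `κ ^ t g`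
has `U`-oscillation at most `ρ ^ (t / d)`, the mixing coefficient is at most `ρ ^ (t / d)` times a
bound on the expectation of `U`, which the drift keeps bounded along the chain.
-/

open scoped NNReal

noncomputable section

section TestFunctions

variable {E F G : Type*} [MeasurableSpace E] [MeasurableSpace F] [MeasurableSpace G]

/-- The measurable functions with values in `[-1, 1]`, against which the total variation distance
of two laws is tested. -/
structure IsTestFunction (φ : E → ℝ) : Prop where
  measurable : Measurable φ
  abs_le_one : ∀ x, |φ x| ≤ 1

lemma IsTestFunction.integrable {φ : E → ℝ} (h : IsTestFunction φ) (μ : Measure E)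
    [IsFiniteMeasure μ] : Integrable φ μ :=
  .of_bound h.measurable.aestronglyMeasurable 1 (ae_of_all _ h.abs_le_one)

lemma abs_integral_le_one {μ : Measure E} [IsProbabilityMeasure μ] {φ : E → ℝ}
    (h : ∀ x, |φ x| ≤ 1) : |∫ x, φ x ∂μ| ≤ 1 := by
  simpa using norm_integral_le_of_norm_le_const (f := φ) (μ := μ) (ae_of_all _ h)

lemma IsTestFunction.integral_prod_right {φ : E × F → ℝ} (h : IsTestFunction φ) (μ : Measure F)
    [IsProbabilityMeasure μ] : IsTestFunction fun x => ∫ z, φ (x, z) ∂μ where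
  measurable := h.measurable.stronglyMeasurable.integral_prod_right'.measurable
  abs_le_one x := abs_integral_le_one fun z => h.abs_le_one (x, z)

lemma exists_isTestFunction_comp {Ω : Type*} {W : Ω → E} {f : Ω → ℝ}
    (hf : @IsTestFunction Ω (MeasurableSpace.comap W inferInstance) f) :
    ∃ g : E → ℝ, IsTestFunction g ∧ f = g ∘ W := by
  obtain ⟨hf, hf_le⟩ := hf
  obtain ⟨g, hg, hfg⟩ := hf.exists_eq_measurable_comp
  refine ⟨fun x => max (-1) (min 1 (g x)), ⟨by fun_prop, fun x => abs_le.2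
    ⟨le_max_left _ _, max_le (by norm_num) (min_le_left _ _)⟩⟩, funext fun ω => ?_⟩
  have bound := abs_le.1 (hf_le ω)
  rw [hfg] at bound ⊢
  exact ((congrArg (max (-1)) (min_eq_right bound.2)).trans (max_eq_right bound.1)).symm

/-- The Markov operator of a kernel `κ`: it maps `φ` to the expectation of `φ` after one step of
`κ`, as a function of the starting point. -/
def markovOperator (κ : Kernel E F) (φ : F → ℝ) (x : E) : ℝ := ∫ y, φ y ∂κ x

lemma IsTestFunction.markovOperator {φ : F → ℝ} (h : IsTestFunction φ) (κ : Kernel E F)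
    [IsMarkovKernel κ] : IsTestFunction (markovOperator κ φ) where
  measurable := (h.measurable.stronglyMeasurable.integral_kernel (κ := κ)).measurable
  abs_le_one _ := abs_integral_le_one h.abs_le_one

lemma markovOperator_comp {φ : G → ℝ} (h : IsTestFunction φ) (η : Kernel F G) [IsMarkovKernel η]
    (κ : Kernel E F) [IsMarkovKernel κ] :
    markovOperator (η ∘ₖ κ) φ = markovOperator κ (markovOperator η φ) :=
  funext fun _ => Kernel.integral_comp (h.integrable _)

lemma integral_comp_measure {φ : F → ℝ} (h : IsTestFunction φ) (κ : Kernel E F) [IsMarkovKernel κ]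
    (μ : Measure E) [IsFiniteMeasure μ] :
    ∫ y, φ y ∂(κ ∘ₘ μ) = ∫ x, markovOperator κ φ x ∂μ := by
  rw [Measure.comp_eq_comp_const_apply, Kernel.integral_comp (h.integrable _), Kernel.const_apply]
  rfl

instance isMarkovKernel_pow (κ : Kernel E E) [IsMarkovKernel κ] (n : ℕ) :
    IsMarkovKernel (κ ^ n) := by
  induction n with
  | zero => exact inferInstanceAs (IsMarkovKernel Kernel.id)
  | succ n _ => exact inferInstanceAs (IsMarkovKernel ((κ ^ n) ∘ₖ κ))

end TestFunctions

section WeightedOscillation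

variable {E : Type*}

/-- The oscillation of `φ` with respect to the weight `U` is at most `L`; this is the dual form of
a bound on a weighted total variation distance. -/
def WeightedOscLE (U : E → ℝ≥0) (L : ℝ≥0) (φ : E → ℝ) : Prop :=
  ∀ x y, |φ x - φ y| ≤ L * (U x + U y)

lemma IsTestFunction.weightedOscLE_one [MeasurableSpace E] {φ : E → ℝ} (h : IsTestFunction φ)
    {U : E → ℝ≥0} (hU : ∀ x, 1 ≤ U x) : WeightedOscLE U 1 φ := fun x y =>
  calc |φ x - φ y| ≤ |φ x| + |φ y| := abs_sub _ _
    _ ≤ U x + U y := add_le_add ((h.abs_le_one x).trans (hU x)) ((h.abs_le_one y).trans (hU y))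
    _ = (1 : ℝ≥0) * (U x + U y) := by simp

lemma WeightedOscLE.exists_center {U : E → ℝ≥0} {L : ℝ≥0} {φ : E → ℝ} (h : WeightedOscLE U L φ) :
    ∃ c, ∀ x, |φ x - c| ≤ L * U x := by
  rcases isEmpty_or_nonempty E with _ | ⟨⟨x₀⟩⟩
  · exact ⟨0, isEmptyElim⟩
  have le_add (x y : E) : φ x - L * U x ≤ φ y + L * U y := by
    linarith [(abs_le.1 (h x y)).2]
  have : Nonempty E := ⟨x₀⟩
  have bdd : BddBelow (Set.range fun y => φ y + L * U y) :=
    ⟨φ x₀ - L * U x₀, Set.forall_mem_range.2 (le_add x₀)⟩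
  refine ⟨⨅ y, (φ y + L * U y), fun x => abs_le.2 ⟨?_, ?_⟩⟩
  · linarith [ciInf_le bdd x]
  · linarith [le_ciInf (le_add x)]

variable [MeasurableSpace E]

lemma integrable_coe_of_lintegral_le {U : E → ℝ≥0} (hU : Measurable U) {μ : Measure E} {b : ℝ≥0}
    (h : ∫⁻ x, U x ∂μ ≤ b) : Integrable (fun x => (U x : ℝ)) μ :=
  ⟨hU.coe_nnreal_real.aestronglyMeasurable,
    hasFiniteIntegral_iff_ofNNReal.2 (h.trans_lt ENNReal.coe_lt_top)⟩

lemma lintegral_one_add_mul_le {V : E → ℝ≥0} (hV : Measurable V) {μ : Measure E}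
    [IsProbabilityMeasure μ] {b : ℝ≥0} (h : ∫⁻ x, V x ∂μ ≤ b) (β : ℝ≥0) :
    ∫⁻ x, (1 + β * V x : ℝ≥0) ∂μ ≤ (1 + β * b : ℝ≥0) := by
  simp only [ENNReal.coe_add, ENNReal.coe_mul]
  rw [lintegral_add_left measurable_const, lintegral_const_mul _ hV.coe_nnreal_ennreal]
  simp only [lintegral_const, measure_univ, mul_one]
  gcongr

lemma WeightedOscLE.sub_integral_le {U : E → ℝ≥0} {ε M : ℝ≥0} {g : E → ℝ}
    (h : WeightedOscLE U ε g) (hg : IsTestFunction g) (hU : Measurable U)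
    {μ : Measure E} [IsProbabilityMeasure μ] (hM : ∫⁻ x, U x ∂μ ≤ M) (x : E) :
    g x - ∫ y, g y ∂μ ≤ ε * (U x + M) := by
  have hUi := integrable_coe_of_lintegral_le hU hM
  calc g x - ∫ y, g y ∂μ = ∫ y, g x - g y ∂μ := by
        rw [integral_sub (integrable_const _) (hg.integrable μ)]
        simp
    _ ≤ ∫ y, ε * ((U x : ℝ) + U y) ∂μ := integral_mono ((integrable_const _).sub (hg.integrable μ))
        (((integrable_const _).add hUi).const_mul _) fun y => (le_abs_self _).trans (h x y)
    _ = ε * (U x + ∫ y, (U y : ℝ) ∂μ) := by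
        rw [integral_const_mul, integral_add (integrable_const _) hUi]
        simp
    _ ≤ ε * (U x + M) := by
        gcongr
        exact integral_coe_le_of_lintegral_coe_le hM

/-- `b - μ.real univ` bounds the `U`-weighted mass of `p - μ`; the proof applies monotonicity in the
measure to the nonnegative functions `L * U ± ψ`. -/
lemma abs_integral_sub_integral_le_of_le {U : E → ℝ≥0} (hU : Measurable U) (hU1 : ∀ x, 1 ≤ U x)
    {μ p : Measure E} (hle : μ ≤ p) {b : ℝ≥0} (hp : ∫⁻ x, U x ∂p ≤ b) {L : ℝ≥0} {ψ : E → ℝ}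
    (hψ : Measurable ψ) (h : ∀ x, |ψ x| ≤ L * U x) :
    |∫ x, ψ x ∂p - ∫ x, ψ x ∂μ| ≤ L * (b - μ.real Set.univ) := by
  have hUp := integrable_coe_of_lintegral_le hU hp
  have hUμ := hUp.mono_measure hle
  have hψp : Integrable ψ p :=
    (hUp.const_mul L).mono' hψ.aestronglyMeasurable (ae_of_all _ h)
  have hψμ := hψp.mono_measure hle
  have mass_le : μ.real Set.univ ≤ ∫ x, (U x : ℝ) ∂μ := by
    simpa using integral_mono_of_nonneg (f := fun _ => (1 : ℝ)) (ae_of_all μ fun _ => zero_le_one)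
      hUμ (ae_of_all μ fun x => hU1 x)
  have sub_le : ∫ x, L * U x - ψ x ∂μ ≤ ∫ x, L * U x - ψ x ∂p :=
    integral_mono_measure hle (ae_of_all _ fun x => sub_nonneg.2 (abs_le.1 (h x)).2)
      ((hUp.const_mul _).sub hψp)
  have add_le : ∫ x, L * U x + ψ x ∂μ ≤ ∫ x, L * U x + ψ x ∂p :=
    integral_mono_measure hle (ae_of_all _ fun x => by
      simpa [add_comm] using neg_le_iff_add_nonneg.1 (abs_le.1 (h x)).1) ((hUp.const_mul _).add hψp)
  rw [integral_sub (hUμ.const_mul _) hψμ, integral_sub (hUp.const_mul _) hψp, integral_const_mul,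
    integral_const_mul] at sub_le
  rw [integral_add (hUμ.const_mul _) hψμ, integral_add (hUp.const_mul _) hψp, integral_const_mul,
    integral_const_mul] at add_le
  have weight_le : L * (∫ x, (U x : ℝ) ∂p - ∫ x, (U x : ℝ) ∂μ) ≤ L * (b - μ.real Set.univ) := by
    gcongr
    exact integral_coe_le_of_lintegral_coe_le hp
  exact abs_le.2 ⟨by linarith, by linarith⟩

end WeightedOscillation

section Harris

variable {E : Type*} [MeasurableSpace E]

/-- The geometric drift condition `κ V ≤ γ V + K` for the Lyapunov function `V`. -/
def GeometricDrift (κ : Kernel E E) (V : E → ℝ≥0) (γ K : ℝ≥0) : Prop :=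
  ∀ x, ∫⁻ y, V y ∂κ x ≤ (γ * V x + K : ℝ≥0)

lemma GeometricDrift.comp {κ η : Kernel E E} [IsMarkovKernel κ] {V : E → ℝ≥0} {γ γ' K K' : ℝ≥0}
    (hη : GeometricDrift η V γ' K') (hκ : GeometricDrift κ V γ K) (hV : Measurable V) :
    GeometricDrift (η ∘ₖ κ) V (γ' * γ) (γ' * K + K') := fun x =>
  calc ∫⁻ z, V z ∂(η ∘ₖ κ) x = ∫⁻ y, ∫⁻ z, V z ∂η y ∂κ x :=
        Kernel.lintegral_comp _ _ _ hV.coe_nnreal_ennreal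
    _ ≤ ∫⁻ y, (γ' * V y + K' : ℝ≥0) ∂κ x := lintegral_mono hη
    _ = γ' * ∫⁻ y, V y ∂κ x + K' := by
        simp only [ENNReal.coe_add, ENNReal.coe_mul]
        rw [lintegral_add_right _ measurable_const, lintegral_const_mul _ hV.coe_nnreal_ennreal]
        simp
    _ ≤ γ' * (γ * V x + K : ℝ≥0) + K' := by gcongr; exact hκ x
    _ = (γ' * γ * V x + (γ' * K + K') : ℝ≥0) := by push_cast; ring

lemma GeometricDrift.pow {κ : Kernel E E} [IsMarkovKernel κ] {V : E → ℝ≥0} {γ K : ℝ≥0}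
    (h : GeometricDrift κ V γ K) (hV : Measurable V) (hγ : γ < 1) (n : ℕ) :
    GeometricDrift (κ ^ n) V (γ ^ n) (K / (1 - γ)) := by
  induction n with
  | zero =>
    intro x
    rw [pow_zero, pow_zero, one_mul]
    exact (lintegral_dirac' x hV.coe_nnreal_ennreal).trans_le (by norm_cast; exact le_self_add)
  | succ n ih =>
    have fixed : γ * (K / (1 - γ)) + K = K / (1 - γ) := by
      have : 1 - γ ≠ 0 := (tsub_pos_of_lt hγ).ne'
      rw [← mul_div_assoc, div_add' _ _ _ this, mul_comm γ, ← mul_add, add_tsub_cancel_of_le hγ.le,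
        mul_one]
    rw [pow_succ', pow_succ', ← fixed]
    exact h.comp ih hV

lemma GeometricDrift.lintegral_comp_le {κ : Kernel E E} {V : E → ℝ≥0} {γ K : ℝ≥0}
    (h : GeometricDrift κ V γ K) (hV : Measurable V) (hγ : γ ≤ 1) (ν : Measure E)
    [IsProbabilityMeasure ν] : ∫⁻ y, V y ∂(κ ∘ₘ ν) ≤ ∫⁻ x, V x ∂ν + K :=
  calc ∫⁻ y, V y ∂(κ ∘ₘ ν) = ∫⁻ x, ∫⁻ y, V y ∂κ x ∂ν :=
        Measure.lintegral_bind κ.aemeasurable hV.coe_nnreal_ennreal.aemeasurable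
    _ ≤ ∫⁻ x, (V x + K : ℝ≥0) ∂ν := lintegral_mono fun x => (h x).trans <| by
        gcongr
        exact mul_le_of_le_one_left' hγ
    _ = ∫⁻ x, V x ∂ν + K := by simp [lintegral_add_right]

/-- The weight `1 + β V` contracts for two reasons: for `V x + V y ≥ R` because of the drift, and
for `V x + V y ≤ R` because of the mass `a` of the minorant, once `β` is small. -/
lemma exists_contraction_constants {γ K R a : ℝ≥0} (hγ : γ < 1)
    (hR : 2 * (K : ℝ) < (1 - γ) * R) (ha : 0 < a) :
    ∃ β ρ : ℝ≥0, 0 < ρ ∧ ρ < 1 ∧ ∀ S : ℝ, 0 ≤ S →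
      2 + β * (γ * S + 2 * K) - 2 * a ≤ ρ * (2 + β * S) ∧
      (R ≤ S → 2 + β * (γ * S + 2 * K) ≤ ρ * (2 + β * S)) := by
  have hγ' : (γ : ℝ) < 1 := hγ
  set gap : ℝ := (1 - γ) * R - 2 * K with hgap
  have gap_pos : 0 < gap := sub_pos.2 hR
  set β : ℝ≥0 := a / (2 * K + 1)
  have hβ : 0 < (β : ℝ) := by positivity
  have hβK : β * (2 * K) ≤ (a : ℝ) := by
    have : (β : ℝ) * (2 * K + 1) = a := by simp only [β]; push_cast; field_simp
    linarith
  set η : ℝ := min (min (a / 2) ((1 - γ) / 2)) (β * gap / (2 + β * R))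
  have hη : 0 < η := lt_min (lt_min (half_pos ha) (half_pos (sub_pos.2 hγ')))
    (div_pos (mul_pos hβ gap_pos) (by positivity))
  have hηa : η ≤ a / 2 := (min_le_left _ _).trans (min_le_left _ _)
  have hηγ : η ≤ (1 - γ) / 2 := (min_le_left _ _).trans (min_le_right _ _)
  have hηR : η * (2 + β * R) ≤ β * gap := (le_div_iff₀ (by positivity)).1 (min_le_right _ _)
  have hγ0 : (0 : ℝ) ≤ γ := γ.coe_nonneg
  have ρ_pos : 0 < 1 - η := by linarith
  refine ⟨β, ⟨1 - η, ρ_pos.le⟩, ρ_pos, NNReal.coe_lt_coe.1 (sub_lt_self 1 hη), fun S hS => ⟨?_, ?_⟩⟩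
  · have : η * (β * S) ≤ (1 - γ) * (β * S) := by gcongr; linarith
    change _ ≤ (1 - η) * _
    linarith
  · intro hRS
    have : 0 ≤ (1 - γ - η) * (β * (S - R)) :=
      mul_nonneg (by linarith) (mul_nonneg hβ.le (sub_nonneg.2 hRS))
    change _ ≤ (1 - η) * _
    rw [hgap] at hηR
    linarith

/-- The Markov operator of `Q` contracts oscillations with respect to the weight `U` by the
factor `ρ`. -/
def ContractsWeightedOsc (Q : Kernel E E) (U : E → ℝ≥0) (ρ : ℝ≥0) : Prop :=
  ∀ (φ : E → ℝ) (L : ℝ≥0), IsTestFunction φ → WeightedOscLE U L φ →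
    WeightedOscLE U (ρ * L) (markovOperator Q φ)

lemma abs_markovOperator_sub_le {Q : Kernel E E} [IsMarkovKernel Q] {V : E → ℝ≥0} {γ K : ℝ≥0}
    (hV : Measurable V) (hQ : GeometricDrift Q V γ K) {μ : Measure E} {x y : E} (hx : μ ≤ Q x)
    (hy : μ ≤ Q y) {β L : ℝ≥0} {φ : E → ℝ} (hφ : IsTestFunction φ)
    (hL : WeightedOscLE (fun x => 1 + β * V x) L φ) :
    |markovOperator Q φ x - markovOperator Q φ y| ≤
      L * (2 + β * (γ * (V x + V y) + 2 * K) - 2 * μ.real Set.univ) := by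
  obtain ⟨c, hc⟩ := hL.exists_center
  have center (z : E) : markovOperator Q φ z = ∫ w, φ w - c ∂Q z + c := by
    rw [integral_sub (hφ.integrable _) (integrable_const c)]
    simp [markovOperator]
  have bound (z : E) (hz : μ ≤ Q z) := abs_integral_sub_integral_le_of_le
    ((hV.const_mul β).const_add 1) (fun _ => le_self_add) hz
    (lintegral_one_add_mul_le hV (hQ z) β) (hφ.measurable.sub_const c) hc
  have bound_x := bound x hx
  have bound_y := bound y hy
  rw [abs_sub_comm] at bound_y
  push_cast at bound_x bound_y
  rw [center, center, add_sub_add_right_eq_sub]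
  linarith [abs_sub_le (∫ w, φ w - c ∂Q x) (∫ w, φ w - c ∂μ) (∫ w, φ w - c ∂Q y)]

/-- Harris' theorem in the dual form of Hairer and Mattingly. -/
theorem exists_contractsWeightedOsc {γ K R a : ℝ≥0} (hγ : γ < 1)
    (hR : 2 * (K : ℝ) < (1 - γ) * R) (ha : 0 < a) :
    ∃ β ρ : ℝ≥0, 0 < ρ ∧ ρ < 1 ∧ ∀ (V : E → ℝ≥0) (Q : Kernel E E) [IsMarkovKernel Q]
      (μ : Measure E), Measurable V → GeometricDrift Q V γ K → (∀ x, V x ≤ R → μ ≤ Q x) →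
      a ≤ μ.real Set.univ → ContractsWeightedOsc Q (fun x => 1 + β * V x) ρ := by
  obtain ⟨β, ρ, hρ0, hρ1, hβρ⟩ := exists_contraction_constants hγ hR ha
  refine ⟨β, ρ, hρ0, hρ1, fun V Q _ μ hV hdrift hμ haμ φ L hφ hL x y => ?_⟩
  obtain ⟨hsmall, hlarge⟩ := hβρ (V x + V y) (by positivity)
  suffices ∃ μ ≤ Q x, μ ≤ Q y ∧ 2 + β * (γ * (V x + V y) + 2 * K) - 2 * μ.real Set.univ ≤
      ρ * (2 + β * (V x + V y : ℝ)) by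
    obtain ⟨μ, hx, hy, hle⟩ := this
    have := (abs_markovOperator_sub_le hV hdrift hx hy hφ hL).trans
      (mul_le_mul_of_nonneg_left hle L.coe_nonneg)
    push_cast
    linarith
  by_cases hS : R ≤ V x + V y
  · exact ⟨0, Measure.zero_le _, Measure.zero_le _, by simpa using hlarge (mod_cast hS)⟩
  · have hS := (not_le.1 hS).le
    exact ⟨μ, hμ x (le_self_add.trans hS), hμ y (le_add_self.trans hS), by linarith⟩

theorem ContractsWeightedOsc.pow {Q : Kernel E E} [IsMarkovKernel Q] {U : E → ℝ≥0} {ρ : ℝ≥0}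
    (hQ : ContractsWeightedOsc Q U ρ) (hU : ∀ x, 1 ≤ U x) {φ : E → ℝ} (hφ : IsTestFunction φ)
    (n : ℕ) : WeightedOscLE U (ρ ^ n) (markovOperator (Q ^ n) φ) := by
  induction n with
  | zero =>
    rw [pow_zero]
    exact (hφ.markovOperator _).weightedOscLE_one hU
  | succ n ih =>
    rw [pow_succ', show Q ^ (n + 1) = (Q ^ n) ∘ₖ Q from pow_succ Q n, markovOperator_comp hφ]
    exact hQ _ _ (hφ.markovOperator _) ih

theorem ContractsWeightedOsc.of_pow {κ : Kernel E E} [IsMarkovKernel κ] {U : E → ℝ≥0} {ρ : ℝ≥0}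
    {d : ℕ} (hκ : ContractsWeightedOsc (κ ^ d) U ρ) (hU : ∀ x, 1 ≤ U x) {φ : E → ℝ}
    (hφ : IsTestFunction φ) (n : ℕ) :
    WeightedOscLE U (ρ ^ (n / d)) (markovOperator (κ ^ n) φ) := by
  have split : κ ^ n = (κ ^ (n % d)) ∘ₖ ((κ ^ d) ^ (n / d)) := by
    conv_lhs => rw [← Nat.mod_add_div n d, pow_add, pow_mul]
    rfl
  rw [split, markovOperator_comp hφ]
  exact hκ.pow hU (hφ.markovOperator _) _

end Harris

section KernelPowers

variable {E S : Type*} [MeasurableSpace E] [MeasurableSpace S]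

/-- The transition kernel of the random recursion `x ↦ F (x, z)`, with `z` of law `μ`. -/
def recursionKernel (F : E × S → E) (μ : Measure S) [SFinite μ] : Kernel E E :=
  (Kernel.id ×ₖ Kernel.const E μ).map F

variable {F : E × S → E} {μ : Measure S} [SFinite μ]

lemma recursionKernel_apply (hF : Measurable F) (x : E) :
    recursionKernel F μ x = μ.map fun z => F (x, z) := by
  rw [recursionKernel, Kernel.map_apply _ hF, Kernel.prod_apply, Kernel.id_apply,
    Kernel.const_apply, Measure.dirac_prod, Measure.map_map hF measurable_prodMk_left]
  rfl

lemma lintegral_recursionKernel (hF : Measurable F) (x : E) {g : E → ℝ≥0∞} (hg : Measurable g) :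
    ∫⁻ y, g y ∂recursionKernel F μ x = ∫⁻ z, g (F (x, z)) ∂μ := by
  rw [recursionKernel_apply hF]
  exact lintegral_map hg (hF.comp measurable_prodMk_left)

lemma isMarkovKernel_recursionKernel (hF : Measurable F) (μ : Measure S) [IsProbabilityMeasure μ] :
    IsMarkovKernel (recursionKernel F μ) :=
  Kernel.IsMarkovKernel.map _ hF

lemma recursionKernel_comp_measure (hF : Measurable F) (ρ : Measure E) [SFinite ρ] :
    recursionKernel F μ ∘ₘ ρ = (ρ.prod μ).map F := by
  rw [recursionKernel, ← Measure.map_comp _ _ hF, ← Measure.compProd_eq_comp_prod,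
    Measure.compProd_const]

/-- `Kernel.pow_succ_apply_eq_lintegral` conditions on the first `n` steps instead. -/
lemma pow_succ_apply_eq_lintegral_pow (κ : Kernel E E) (n : ℕ) {A : Set E} (hA : MeasurableSet A)
    (x : E) : (κ ^ (n + 1)) x A = ∫⁻ y, (κ ^ n) y A ∂κ x := by
  rw [pow_succ]
  exact Kernel.comp_apply' _ _ _ hA

lemma pow_apply_univ_of_forall_apply_univ {κ : Kernel E E} {a : ℝ≥0∞}
    (h : ∀ x, κ x Set.univ = a) (n : ℕ) (x : E) : (κ ^ n) x Set.univ = a ^ n := by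
  induction n generalizing x with
  | zero =>
    rw [pow_zero, pow_zero]
    exact measure_univ (μ := Kernel.id x)
  | succ n ih =>
    rw [pow_succ_apply_eq_lintegral_pow _ _ .univ]
    simp only [ih, lintegral_const, h, pow_succ]

lemma pow_apply_le_pow_apply {κ η : Kernel E E} {B : Set E} (hle : ∀ x ∈ B, η x ≤ κ x)
    (hB : ∀ x ∈ B, ∀ᵐ y ∂η x, y ∈ B) (n : ℕ) : ∀ x ∈ B, (η ^ n) x ≤ (κ ^ n) x := by
  induction n with
  | zero => exact fun x _ => le_rfl
  | succ n ih =>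
    intro x hx
    refine Measure.le_iff.2 fun A hA => ?_
    rw [pow_succ_apply_eq_lintegral_pow _ _ hA, pow_succ_apply_eq_lintegral_pow _ _ hA]
    calc ∫⁻ y, (η ^ n) y A ∂η x ≤ ∫⁻ y, (κ ^ n) y A ∂η x :=
          lintegral_mono_ae <| (hB x hx).mono fun y hy => ih y hy A
      _ ≤ ∫⁻ y, (κ ^ n) y A ∂κ x := lintegral_mono' (hle x hx) le_rfl

end KernelPowers

section AutoregressiveKernel

variable {d : ℕ}

/-- The vector `(y, x 0, …, x (d - 2))`: the newest value `y` enters and the oldest one leaves. -/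
def push (x : Fin d → ℝ) (y : ℝ) : Fin d → ℝ :=
  fun i => (Fin.cons y x : Fin (d + 1) → ℝ) i.castSucc

lemma measurable_push : Measurable fun p : (Fin d → ℝ) × ℝ => push p.1 p.2 := by
  refine measurable_pi_lambda _ fun i => ?_
  cases h : i.castSucc using Fin.cases with
  | zero => simpa only [push, h, Fin.cons_zero] using measurable_snd
  | succ j =>
    simp only [push, h, Fin.cons_succ]
    fun_prop

lemma measurable_push_right (x : Fin d → ℝ) : Measurable (push x) :=
  measurable_push.comp measurable_prodMk_left

lemma norm_push_le {x : Fin d → ℝ} {y r : ℝ} (hx : ‖x‖ ≤ r) (hy : |y| ≤ r) : ‖push x y‖ ≤ r := by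
  refine (pi_norm_le_iff_of_nonneg ((norm_nonneg x).trans hx)).2 fun i => ?_
  cases h : i.castSucc using Fin.cases with
  | zero => simpa only [push, h, Fin.cons_zero] using! hy
  | succ j => simpa only [push, h, Fin.cons_succ] using (norm_le_pi_norm x j).trans hx

/-- The transition kernel of the autoregression with regression function `f` and noise law `η`, on
the vectors of the `d` latest values. -/
def arKernel (f : (Fin d → ℝ) → ℝ) (η : Measure ℝ) [SFinite η] :
    Kernel (Fin d → ℝ) (Fin d → ℝ) :=
  recursionKernel (fun p => push p.1 (f p.1 + p.2)) η

variable {f : (Fin d → ℝ) → ℝ} {η : Measure ℝ} [SFinite η]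

lemma measurable_push_add (hf : Measurable f) :
    Measurable fun p : (Fin d → ℝ) × ℝ => push p.1 (f p.1 + p.2) :=
  measurable_push.comp (by fun_prop : Measurable fun p : (Fin d → ℝ) × ℝ => (p.1, f p.1 + p.2))

lemma arKernel_apply (hf : Measurable f) (x : Fin d → ℝ) :
    arKernel f η x = (η.map (f x + ·)).map (push x) := by
  rw [arKernel, recursionKernel_apply (measurable_push_add hf)]
  exact (Measure.map_map (measurable_push_right x) (measurable_const_add (f x))).symm

lemma isMarkovKernel_arKernel (hf : Measurable f) (η : Measure ℝ) [IsProbabilityMeasure η] :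
    IsMarkovKernel (arKernel f η) :=
  isMarkovKernel_recursionKernel (measurable_push_add hf) η

/-- With regression function `0`, each step forgets the oldest remaining coordinate of the starting
point. -/
lemma arKernel_zero_pow_apply_congr (n : ℕ) {x y : Fin d → ℝ}
    (h : ∀ i : Fin d, i + n < d → x i = y i) : (arKernel 0 η ^ n) x = (arKernel 0 η ^ n) y := by
  induction n generalizing x y with
  | zero => rw [show x = y from funext fun i => h i i.2]
  | succ n ih =>
    ext A hA
    have step (x : Fin d → ℝ) : (arKernel 0 η ^ (n + 1)) x A
        = ∫⁻ z, (arKernel 0 η ^ n) (push x z) A ∂η := by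
      rw [pow_succ_apply_eq_lintegral_pow _ _ hA, arKernel_apply measurable_zero,
        lintegral_map (Kernel.measurable_coe _ hA) (measurable_push_right x)]
      simp
    rw [step, step]
    refine lintegral_congr fun z => congrArg (· A) (ih fun i hi => ?_)
    cases hj : i.castSucc using Fin.cases with
    | zero => simp only [push, hj, Fin.cons_zero]
    | succ j =>
      have : (i : ℕ) = j + 1 := congrArg Fin.val hj
      simpa only [push, hj, Fin.cons_succ] using h j (by omega)

end AutoregressiveKernel

section Minorization

/-- `η` dominates a positive multiple of Lebesgue measure on every bounded interval. -/
def LocallyDominatesVolume (η : Measure ℝ) : Prop :=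
  ∀ M : ℝ, ∃ δ : ℝ≥0, 0 < δ ∧ δ • volume.restrict (Set.Icc (-M) M) ≤ η

lemma locallyDominatesVolume_gaussianReal (m : ℝ) {v : ℝ≥0} (hv : v ≠ 0) :
    LocallyDominatesVolume (gaussianReal m v) := by
  intro M
  refine ⟨(gaussianPDFReal m v (m + (|m| + |M|))).toNNReal,
    Real.toNNReal_pos.2 (gaussianPDFReal_pos _ _ _ hv), ?_⟩
  rw [gaussianReal_of_var_ne_zero m hv, ← Measure.coe_nnreal_smul, ← withDensity_const,
    ← withDensity_indicator measurableSet_Icc]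
  refine withDensity_mono (ae_of_all _ (Set.indicator_le fun y hy => ?_))
  have : |y - m| ≤ |m| + |M| := by
    linarith [abs_sub y m, (abs_le.2 hy).trans (le_abs_self M)]
  refine ENNReal.ofReal_le_ofReal ?_
  simp only [gaussianPDFReal, add_sub_cancel_left]
  gcongr ?_ * Real.exp (-?_ / _)
  exact sq_le_sq.2 (this.trans (le_abs_self _))

/-- Translating the interval keeps it inside a larger one, so one minorant serves all
translations. -/
lemma LocallyDominatesVolume.exists_le_map_add {η : Measure ℝ} (hη : LocallyDominatesVolume η)
    (M r : ℝ) : ∃ δ : ℝ≥0, 0 < δ ∧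
      ∀ a, |a| ≤ M → δ • volume.restrict (Set.Icc (-r) r) ≤ η.map (a + ·) := by
  obtain ⟨δ, hδ, hle⟩ := hη (M + r)
  refine ⟨δ, hδ, fun a ha => ?_⟩
  have translate := (measurePreserving_add_left volume a).restrict_preimage
    (measurableSet_Icc (a := -r) (b := r))
  have subset : (a + ·) ⁻¹' Set.Icc (-r) r ⊆ Set.Icc (-(M + r)) (M + r) := fun z hz => by
    have := abs_le.1 ha
    exact ⟨by linarith [hz.1], by linarith [hz.2]⟩
  rw [← translate.map_eq, ← Measure.map_smul]
  refine Measure.map_mono (le_trans ?_ hle) (measurable_const_add a)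
  gcongr

/-- The minorant is the law of `d` steps of pure noise truncated to `[-r, r]`. -/
lemma LocallyDominatesVolume.exists_minorization {η : Measure ℝ} [SFinite η]
    (hη : LocallyDominatesVolume η) (d : ℕ) (M : ℝ) {r : ℝ} (hr : 0 < r) :
    ∃ (μ : Measure (Fin d → ℝ)) (a : ℝ≥0), 0 < a ∧ a ≤ μ.real Set.univ ∧
      ∀ f : (Fin d → ℝ) → ℝ, Measurable f → (∀ x, ‖x‖ ≤ r → |f x| ≤ M) →
        ∀ x, ‖x‖ ≤ r → μ ≤ (arKernel f η ^ d) x := by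
  obtain ⟨δ, hδ, hle⟩ := hη.exists_le_map_add M r
  set noise : Measure ℝ := δ • volume.restrict (Set.Icc (-r) r)
  have zero_apply (x : Fin d → ℝ) : arKernel 0 noise x = noise.map (push x) := by
    rw [arKernel_apply measurable_zero]
    simp
  refine ⟨(arKernel 0 noise ^ d) 0, (δ * (2 * r).toNNReal) ^ d, by positivity, ?_,
    fun f hf hM x hx => ?_⟩
  · have mass (x : Fin d → ℝ) : arKernel 0 noise x Set.univ = (δ * (2 * r).toNNReal : ℝ≥0) := by
      rw [zero_apply, Measure.map_apply (measurable_push_right x) .univ]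
      rw [Set.preimage_univ, Measure.smul_apply, Measure.restrict_apply_univ, Real.volume_Icc,
        sub_neg_eq_add, ← two_mul]
      rfl
    rw [measureReal_def, pow_apply_univ_of_forall_apply_univ mass]
    simp
  · have forget : (arKernel 0 noise ^ d) 0 = (arKernel 0 noise ^ d) x :=
      arKernel_zero_pow_apply_congr d fun i hi => by omega
    rw [forget]
    refine pow_apply_le_pow_apply (B := {x | ‖x‖ ≤ r}) (fun y hy => ?_) (fun y hy => ?_) d x hx
    · rw [zero_apply, arKernel_apply hf]
      exact Measure.map_mono (hle _ (hM y hy)) (measurable_push_right y)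
    · rw [zero_apply]
      refine (ae_map_iff (measurable_push_right y).aemeasurable
        (measurableSet_le measurable_norm measurable_const)).2 ?_
      have in_Icc : ∀ᵐ z ∂noise, z ∈ Set.Icc (-r) r :=
        Measure.ae_smul_measure (ae_restrict_mem measurableSet_Icc) _
      exact in_Icc.mono fun z hz => norm_push_le hy (abs_le.2 hz)

end Minorization

section Lyapunov

variable {d : ℕ}

/-- The Lyapunov function of the autoregression: a weighted `ℓ¹` norm on the last `d` values. The
superfluous weight `w d`, taken to be `0`, makes the recursion between consecutive weights
uniform. -/
def weightedNorm (w : Fin (d + 1) → ℝ≥0) (x : Fin d → ℝ) : ℝ≥0 :=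
  ∑ i : Fin d, w i.castSucc * ‖x i‖₊

lemma measurable_weightedNorm (w : Fin (d + 1) → ℝ≥0) : Measurable (weightedNorm w) := by
  unfold weightedNorm
  fun_prop

lemma weightedNorm_le (w : Fin (d + 1) → ℝ≥0) (x : Fin d → ℝ) :
    weightedNorm w x ≤ (∑ i : Fin d, w i.castSucc) * ‖x‖₊ := by
  rw [weightedNorm, Finset.sum_mul]
  gcongr with i
  exact nnnorm_le_pi_nnnorm x i

lemma norm_le_of_weightedNorm_le {w : Fin (d + 1) → ℝ≥0} {ε : ℝ≥0} (hε : 0 < ε)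
    (hw : ∀ i : Fin d, ε ≤ w i.castSucc) {x : Fin d → ℝ} {R : ℝ≥0} (hx : weightedNorm w x ≤ R) :
    ‖x‖ ≤ R / ε := by
  refine (pi_norm_le_iff_of_nonneg (by positivity)).2 fun i => ?_
  have : ε * ‖x i‖₊ ≤ R := calc
    ε * ‖x i‖₊ ≤ w i.castSucc * ‖x i‖₊ := by gcongr; exact hw i
    _ ≤ weightedNorm w x := Finset.single_le_sum (f := fun i : Fin d => w i.castSucc * ‖x i‖₊)
        (fun _ _ => zero_le) (Finset.mem_univ i)
    _ ≤ R := hx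
  exact (le_div_iff₀' (by exact_mod_cast hε)).2 (mod_cast this)

lemma weightedNorm_push {w : Fin (d + 1) → ℝ≥0} (hw : w (Fin.last d) = 0) (x : Fin d → ℝ) (y : ℝ) :
    weightedNorm w (push x y) = w 0 * ‖y‖₊ + ∑ i : Fin d, w i.succ * ‖x i‖₊ := by
  have sum_cons : ∑ j, w j * ‖(Fin.cons y x : Fin (d + 1) → ℝ) j‖₊ = weightedNorm w (push x y) := by
    rw [Fin.sum_univ_castSucc, hw, zero_mul, add_zero]
    rfl
  rw [← sum_cons, Fin.sum_univ_succ]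
  simp only [Fin.cons_zero, Fin.cons_succ]

/-- With `ε = (1 - ∑ i, c i) / (d + 1)`, the weight `w j` is the sum of the `c i + ε` over `i ≥ j`;
in particular `w 0 = 1 - ε`, which is also the rate `γ`. -/
lemma exists_weights {c : Fin d → ℝ≥0} (hc : ∑ i, c i < 1) :
    ∃ (w : Fin (d + 1) → ℝ≥0) (γ ε : ℝ≥0), γ < 1 ∧ 0 < ε ∧ w (Fin.last d) = 0 ∧
      (∀ i : Fin d, ε ≤ w i.castSucc) ∧
      ∀ i : Fin d, w 0 * c i + w i.succ ≤ γ * w i.castSucc := by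
  set ε : ℝ≥0 := (1 - ∑ i, c i) / (d + 1)
  have hε : 0 < ε := div_pos (tsub_pos_of_lt hc) (by positivity)
  have sum_add : ∑ i, (c i + ε) + ε = 1 := by
    have : (d + 1) * ε = 1 - ∑ i, c i := mul_div_cancel₀ _ (by positivity)
    rw [Finset.sum_add_distrib, Finset.sum_const, Finset.card_univ, Fintype.card_fin, nsmul_eq_mul,
      add_assoc, ← add_one_mul, this, add_tsub_cancel_of_le hc.le]
  let w : Fin (d + 1) → ℝ≥0 := fun j => ∑ i with j ≤ i.castSucc, (c i + ε)
  have w_zero : w 0 + ε = 1 := by simpa only [w, Fin.zero_le, Finset.filter_true] using sum_add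
  have w_le (j : Fin (d + 1)) : w j ≤ w 0 :=
    Finset.sum_le_sum_of_subset (Finset.monotone_filter_right _ fun _ _ _ => Fin.zero_le _)
  have w_castSucc (i : Fin d) : w i.castSucc = c i + ε + w i.succ := by
    have : Finset.univ.filter (fun k : Fin d => i.castSucc ≤ k.castSucc)
        = insert i (Finset.univ.filter fun k => i.succ ≤ k.castSucc) := by
      ext k
      simp only [Finset.mem_filter_univ, Finset.mem_insert, Fin.le_def, Fin.ext_iff,
        Fin.val_castSucc, Fin.val_succ]
      omega
    simp only [w]
    rw [this, Finset.sum_insert (by simp [Fin.le_def])]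
  refine ⟨w, w 0, ε, by simpa [← w_zero] using hε, hε, ?_, fun i => ?_, fun i => ?_⟩
  · exact Finset.sum_eq_zero fun i hi =>
      absurd (Finset.mem_filter.1 hi).2 (not_le.2 i.castSucc_lt_last)
  · rw [w_castSucc]
    exact le_add_right le_add_self
  · calc w 0 * c i + w i.succ = w 0 * c i + (w 0 + ε) * w i.succ := by rw [w_zero, one_mul]
      _ ≤ w 0 * c i + (w 0 * w i.succ + ε * w 0) := by
        rw [add_mul]
        gcongr
        exact w_le _
      _ = w 0 * w i.castSucc := by rw [w_castSucc]; ring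

lemma weightedNorm_push_le {w : Fin (d + 1) → ℝ≥0} {γ : ℝ≥0} {c : Fin (d + 1) → ℝ≥0}
    (hw : w (Fin.last d) = 0)
    (hγ : ∀ i : Fin d, w 0 * c i.succ + w i.succ ≤ γ * w i.castSucc) {m : (Fin d → ℝ) → ℝ}
    (hm : ∀ x, ‖m x‖₊ ≤ c 0 + ∑ i : Fin d, c i.succ * ‖x i‖₊) (x : Fin d → ℝ) (z : ℝ) :
    weightedNorm w (push x (m x + z)) ≤ γ * weightedNorm w x + w 0 * (c 0 + ‖z‖₊) :=
  calc weightedNorm w (push x (m x + z))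
      = w 0 * ‖m x + z‖₊ + ∑ i : Fin d, w i.succ * ‖x i‖₊ := weightedNorm_push hw x _
    _ ≤ w 0 * (c 0 + ∑ i : Fin d, c i.succ * ‖x i‖₊ + ‖z‖₊)
          + ∑ i : Fin d, w i.succ * ‖x i‖₊ := by
        gcongr
        exact (nnnorm_add_le _ _).trans (by gcongr; exact hm x)
    _ = ∑ i : Fin d, (w 0 * c i.succ + w i.succ) * ‖x i‖₊ + w 0 * (c 0 + ‖z‖₊) := by
        simp only [add_mul, Finset.sum_add_distrib, mul_add, Finset.mul_sum, mul_assoc]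
        ring
    _ ≤ ∑ i : Fin d, γ * w i.castSucc * ‖x i‖₊ + w 0 * (c 0 + ‖z‖₊) := by
        gcongr with i
        exact hγ i
    _ = γ * weightedNorm w x + w 0 * (c 0 + ‖z‖₊) := by
        simp only [weightedNorm, Finset.mul_sum, mul_assoc]

lemma geometricDrift_arKernel {w : Fin (d + 1) → ℝ≥0} {γ : ℝ≥0} {c : Fin (d + 1) → ℝ≥0}
    (hw : w (Fin.last d) = 0)
    (hγ : ∀ i : Fin d, w 0 * c i.succ + w i.succ ≤ γ * w i.castSucc)
    {η : Measure ℝ} [IsProbabilityMeasure η] {b : ℝ≥0} (hη : ∫⁻ z, ‖z‖₊ ∂η ≤ b)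
    {m : (Fin d → ℝ) → ℝ} (hm : Measurable m)
    (hmc : ∀ x, ‖m x‖₊ ≤ c 0 + ∑ i : Fin d, c i.succ * ‖x i‖₊) :
    GeometricDrift (arKernel m η) (weightedNorm w) γ (w 0 * (c 0 + b)) := fun x =>
  calc ∫⁻ y, weightedNorm w y ∂arKernel m η x
      = ∫⁻ z, weightedNorm w (push x (m x + z)) ∂η :=
        lintegral_recursionKernel (measurable_push_add hm) x
          (measurable_weightedNorm w).coe_nnreal_ennreal
    _ ≤ ∫⁻ z, (γ * weightedNorm w x + w 0 * (c 0 + ‖z‖₊) : ℝ≥0) ∂η := by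
        gcongr with z
        exact weightedNorm_push_le hw hγ hmc x z
    _ = γ * weightedNorm w x + w 0 * (c 0 + ∫⁻ z, ‖z‖₊ ∂η) := by
        simp only [ENNReal.coe_add, ENNReal.coe_mul]
        rw [lintegral_add_left measurable_const, lintegral_const_mul (w 0 : ℝ≥0∞) (by fun_prop),
          lintegral_add_left measurable_const]
        simp only [lintegral_const, measure_univ, mul_one]
    _ ≤ (γ * weightedNorm w x + w 0 * (c 0 + b) : ℝ≥0) := by
        push_cast
        gcongr

end Lyapunov

section UniformErgodicity

variable {d : ℕ} {c : Fin (d + 1) → ℝ≥0} {m : (Fin d → ℝ) → ℝ}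

lemma nnnorm_le_of_mem_regressionClass (hm : m ∈ regressionClass fun i => (c i : ℝ))
    (x : Fin d → ℝ) : ‖m x‖₊ ≤ c 0 + ∑ i : Fin d, c i.succ * ‖x i‖₊ := by
  rw [← NNReal.coe_le_coe]
  push_cast
  exact hm.2 x

lemma abs_le_of_mem_regressionClass (hm : m ∈ regressionClass fun i => (c i : ℝ))
    {x : Fin d → ℝ} {r : ℝ} (hx : ‖x‖ ≤ r) : |m x| ≤ c 0 + ∑ i : Fin d, c i.succ * r := by
  refine (hm.2 x).trans ?_
  gcongr with i
  exact (norm_le_pi_norm x i).trans hx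

lemma lintegral_weightedNorm_ne_top {ν : Measure (Fin d → ℝ)} (hν : ∫⁻ x, ‖x‖₊ ∂ν ≠ ∞)
    (w : Fin (d + 1) → ℝ≥0) : ∫⁻ x, weightedNorm w x ∂ν ≠ ∞ := by
  refine ne_top_of_le_ne_top ?_ (lintegral_mono fun x => ENNReal.coe_le_coe.2 (weightedNorm_le w x))
  simp only [ENNReal.coe_mul]
  rw [lintegral_const_mul _ (by fun_prop)]
  exact ENNReal.mul_ne_top ENNReal.coe_ne_top hν

/-- The constants serve every regression function in the class, because so do the drift and the
minorization. -/
theorem exists_uniform_contraction (hd : d ≠ 0) (hc : ∑ i : Fin d, c i.succ < 1) {η : Measure ℝ}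
    [IsProbabilityMeasure η] (hη : LocallyDominatesVolume η) (hη_fin : ∫⁻ z, ‖z‖₊ ∂η ≠ ∞)
    {ν : Measure (Fin d → ℝ)} [IsProbabilityMeasure ν] (hν : ∫⁻ x, ‖x‖₊ ∂ν ≠ ∞) :
    ∃ (U : (Fin d → ℝ) → ℝ≥0) (ρ M : ℝ≥0), Measurable U ∧ (∀ x, 1 ≤ U x) ∧ 0 < ρ ∧ ρ < 1 ∧
      ∀ m ∈ regressionClass fun i => (c i : ℝ), ContractsWeightedOsc (arKernel m η ^ d) U ρ ∧
        ∀ n : ℕ, ∫⁻ x, U x ∂((arKernel m η ^ n) ∘ₘ ν) ≤ M := by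
  obtain ⟨w, γ, ε, hγ, hε, w_last, hεw, hw⟩ := exists_weights hc
  lift ∫⁻ z, ‖z‖₊ ∂η to ℝ≥0 using hη_fin with b hb
  lift ∫⁻ x, weightedNorm w x ∂ν to ℝ≥0 using lintegral_weightedNorm_ne_top hν w with B hB
  set K : ℝ≥0 := w 0 * (c 0 + b) / (1 - γ)
  have hV := measurable_weightedNorm w
  have drift {m} (hm : m ∈ regressionClass fun i => (c i : ℝ)) (n : ℕ) :
      GeometricDrift (arKernel m η ^ n) (weightedNorm w) (γ ^ n) K := by
    have := isMarkovKernel_arKernel hm.1 η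
    exact (geometricDrift_arKernel w_last hw hb.ge hm.1
      (nnnorm_le_of_mem_regressionClass hm)).pow hV hγ n
  have hγd : γ ^ d < 1 := pow_lt_one₀ zero_le hγ hd
  have hγd' : (0 : ℝ) < 1 - (γ ^ d : ℝ≥0) := sub_pos.2 hγd
  set R : ℝ≥0 := (2 * K + 1) / (1 - γ ^ d)
  have hR : 2 * (K : ℝ) < (1 - (γ ^ d : ℝ≥0)) * R := by
    simp only [R, NNReal.coe_div, NNReal.coe_sub hγd.le]
    rw [NNReal.coe_one, mul_div_cancel₀ _ hγd'.ne']
    push_cast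
    linarith
  obtain ⟨μ, a, ha, haμ, minorant⟩ := hη.exists_minorization d
    (c 0 + ∑ i : Fin d, c i.succ * (R / ε + 1 : ℝ)) (r := R / ε + 1) (by positivity)
  obtain ⟨β, ρ, hρ0, hρ1, contraction⟩ := exists_contractsWeightedOsc (E := Fin d → ℝ) hγd hR ha
  refine ⟨fun x => 1 + β * weightedNorm w x, ρ, 1 + β * (B + K), (hV.const_mul β).const_add 1,
    fun _ => le_self_add, hρ0, hρ1, fun m hm => ?_⟩
  have := isMarkovKernel_arKernel hm.1 η
  refine ⟨contraction (weightedNorm w) _ μ hV (drift hm d) (fun x hx => ?_) haμ, fun n => ?_⟩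
  · exact minorant m hm.1 (fun y hy => abs_le_of_mem_regressionClass hm hy) x
      ((norm_le_of_weightedNorm_le hε hεw hx).trans (by simp))
  · refine lintegral_one_add_mul_le hV ?_ β
    rw [ENNReal.coe_add, hB]
    exact (drift hm n).lintegral_comp_le hV (pow_le_one₀ zero_le hγ.le) ν

end UniformErgodicity

section Independence

variable {Ω S S' : Type*} {𝓕 : MeasurableSpace Ω} [mΩ : MeasurableSpace Ω] [MeasurableSpace S]
  [MeasurableSpace S'] {P : Measure Ω} [IsProbabilityMeasure P]

lemma indepFun_prodMk_left_of_indepFun_prodMk_right {R : Type*} [MeasurableSpace R] {X : Ω → R}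
    {Y : Ω → S} {Z : Ω → S'} (hX : Measurable X) (hY : Measurable Y) (hZ : Measurable Z)
    (hXYZ : IndepFun X (fun ω => (Y ω, Z ω)) P) (hYZ : IndepFun Y Z P) :
    IndepFun (fun ω => (X ω, Y ω)) Z P := by
  have hXY : IndepFun X Y P := hXYZ.comp measurable_id measurable_fst
  have law_XYZ := (indepFun_iff_map_prod_eq_prod_map_map hX.aemeasurable
    (hY.prodMk hZ).aemeasurable).1 hXYZ
  have law_YZ := (indepFun_iff_map_prod_eq_prod_map_map hY.aemeasurable hZ.aemeasurable).1 hYZ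
  have law_XY := (indepFun_iff_map_prod_eq_prod_map_map hX.aemeasurable hY.aemeasurable).1 hXY
  refine (indepFun_iff_map_prod_eq_prod_map_map (hX.prodMk hY).aemeasurable hZ.aemeasurable).2 ?_
  refine (MeasurableEquiv.prodAssoc (α := R) (β := S) (γ := S')).map_measurableEquiv_injective ?_
  rw [law_XY, Measure.prodAssoc_prod, ← law_YZ, ← law_XYZ,
    Measure.map_map (MeasurableEquiv.measurable _) ((hX.prodMk hY).prodMk hZ)]
  rfl

lemma map_restrict_prodMk_of_indep (h𝓕 : 𝓕 ≤ mΩ) {X : Ω → S} (hX : Measurable[𝓕] X) {Z : Ω → S'}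
    (hZ : Measurable Z) (h : Indep 𝓕 (MeasurableSpace.comap Z inferInstance) P) {A : Set Ω}
    (hA : MeasurableSet[𝓕] A) :
    (P.restrict A).map (fun ω => (X ω, Z ω)) = ((P.restrict A).map X).prod (P.map Z) := by
  have hX' : Measurable X := hX.mono h𝓕 le_rfl
  refine (Measure.prod_eq fun s t hs ht => ?_).symm
  rw [Measure.map_apply (hX'.prodMk hZ) (hs.prod ht), Measure.map_apply hX' hs,
    Measure.map_apply hZ ht, Measure.restrict_apply ((hX'.prodMk hZ) (hs.prod ht)),
    Measure.restrict_apply (hX' hs)]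
  rw [← (Indep_iff _ _ P).1 h (X ⁻¹' s ∩ A) (Z ⁻¹' t) ((hX hs).inter hA) ⟨t, ht, rfl⟩,
    Set.inter_right_comm]
  rfl

lemma setIntegral_prodMk_of_indep (h𝓕 : 𝓕 ≤ mΩ) {X : Ω → S} (hX : Measurable[𝓕] X) {Z : Ω → S'}
    (hZ : Measurable Z) (h : Indep 𝓕 (MeasurableSpace.comap Z inferInstance) P) {A : Set Ω}
    (hA : MeasurableSet[𝓕] A) {F : S × S' → ℝ} (hF : IsTestFunction F) :
    ∫ ω in A, F (X ω, Z ω) ∂P = ∫ ω in A, ∫ z, F (X ω, z) ∂P.map Z ∂P := by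
  have hX' : Measurable X := hX.mono h𝓕 le_rfl
  have := Measure.isProbabilityMeasure_map (μ := P) hZ.aemeasurable
  calc ∫ ω in A, F (X ω, Z ω) ∂P = ∫ p, F p ∂((P.restrict A).map X).prod (P.map Z) := by
        rw [← map_restrict_prodMk_of_indep h𝓕 hX hZ h hA,
          integral_map (hX'.prodMk hZ).aemeasurable hF.measurable.aestronglyMeasurable]
    _ = ∫ x, ∫ z, F (x, z) ∂P.map Z ∂(P.restrict A).map X := integral_prod _ (hF.integrable _)
    _ = ∫ ω in A, ∫ z, F (X ω, z) ∂P.map Z ∂P :=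
        integral_map hX'.aemeasurable (hF.integral_prod_right _).measurable.aestronglyMeasurable

end Independence

section SigmaField

variable {Ω : Type*} {Y : ℤ → Ω → ℝ}

lemma sigmaField_eq_comap (Y : ℤ → Ω → ℝ) (a b : ℤ) : sigmaField Y a b =
    MeasurableSpace.comap (fun ω (r : Set.Icc a b) => Y r ω) inferInstance := by
  rw [sigmaField, iSup_subtype', BorelSpace.measurable_eq.symm]
  simp only [MeasurableSpace.pi, MeasurableSpace.comap_iSup, MeasurableSpace.comap_comp]
  rfl

lemma measurable_sigmaField {a b r : ℤ} (hr : r ∈ Set.Icc a b) :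
    Measurable[sigmaField Y a b] (Y r) := by
  rw [sigmaField_eq_comap]
  exact (measurable_pi_apply (⟨r, hr⟩ : Set.Icc a b)).comp
    (comap_measurable fun ω (r : Set.Icc a b) => Y r ω)

lemma sigmaField_mono {a b a' b' : ℤ} (ha : a' ≤ a) (hb : b ≤ b') :
    sigmaField Y a b ≤ sigmaField Y a' b' :=
  biSup_mono fun _ hr => ⟨ha.trans hr.1, hr.2.trans hb⟩

lemma measurable_lagVector {d : ℕ} {s : ℤ} (hs : 0 ≤ s) :
    Measurable[sigmaField Y (1 - d) s] (lagVector d Y (s + 1)) := by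
  refine @measurable_pi_lambda _ _ _ (_) _ _ fun i => measurable_sigmaField ⟨?_, ?_⟩ <;> omega

end SigmaField

namespace IsNonlinearAR

variable {Ω : Type*} [mΩ : MeasurableSpace Ω] {P : Measure Ω} {d T : ℕ}
  {ν : Measure (Fin d → ℝ)} {m : (Fin d → ℝ) → ℝ} {Y v : ℤ → Ω → ℝ}

lemma sigmaField_le (h : IsNonlinearAR P d T ν m Y v) {a b : ℤ} (ha : 1 - d ≤ a) (hb : b ≤ T) :
    sigmaField Y a b ≤ mΩ :=
  iSup₂_le fun r hr => (h.measurable_Y r ⟨ha.trans hr.1, hr.2.trans hb⟩).comap_le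

lemma measurable_lagVector_succ (h : IsNonlinearAR P d T ν m Y v) {s : ℤ} (hs : 0 ≤ s)
    (hsT : s ≤ T) : Measurable (lagVector d Y (s + 1)) :=
  (measurable_lagVector hs).mono (h.sigmaField_le le_rfl hsT) le_rfl

lemma measurable_noise (h : IsNonlinearAR P d T ν m Y v) (J : Finset (Set.Icc (1 : ℤ) T)) :
    Measurable fun ω (i : J) => v i ω :=
  measurable_pi_lambda _ fun i => h.measurable_v _ i.1.2

lemma exists_eq_comp_lagVector_noise (h : IsNonlinearAR P d T ν m Y v) (hm : Measurable m) {s u : ℤ}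
    (hs : 0 ≤ s) (hu : u ≤ T) {J : Finset (Set.Icc (1 : ℤ) T)}
    (hJ : ∀ i : Set.Icc (1 : ℤ) T, s < i → i ≤ u → i ∈ J) {r : ℤ} (hsr : s + 1 - d ≤ r)
    (hru : r ≤ u) : ∃ g : (Fin d → ℝ) × (J → ℝ) → ℝ, Measurable g ∧
      ∀ᵐ ω ∂P, Y r ω = g (lagVector d Y (s + 1) ω, fun i : J => v i ω) := by
  induction hn : (r - (s + 1 - d)).toNat using Nat.strong_induction_on generalizing r with
  | _ n ih =>
    by_cases hrs : r ≤ s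
    · refine ⟨fun p => p.1 ⟨(s - r).toNat, by omega⟩, by fun_prop, ae_of_all _ fun ω => ?_⟩
      simp only [lagVector]
      congr
      omega
    · have hr : r ∈ Set.Icc (1 : ℤ) T := ⟨by omega, by omega⟩
      choose g hg hgY using fun i : Fin d =>
        ih (r - 1 - (i : ℕ) - (s + 1 - d)).toNat (by omega) (by omega) (by omega) rfl
      refine ⟨fun p => m (fun i => g i p) + p.2 ⟨⟨r, hr⟩, hJ ⟨r, hr⟩ (not_le.1 hrs) hru⟩,
        (hm.comp (measurable_pi_lambda _ hg)).add (by fun_prop), ?_⟩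
      filter_upwards [h.recursion r hr, ae_all_iff.2 hgY] with ω hY hlag
      rw [hY]
      congr 2
      exact funext hlag

lemma exists_path_eq_comp_lagVector_noise (h : IsNonlinearAR P d T ν m Y v) (hm : Measurable m)
    {s u : ℤ} (hs : 0 ≤ s) (hu : u ≤ T) {J : Finset (Set.Icc (1 : ℤ) T)}
    (hJ : ∀ i : Set.Icc (1 : ℤ) T, s < i → i ≤ u → i ∈ J) {a : ℤ} (ha : s + 1 - d ≤ a) :
    ∃ g : (Fin d → ℝ) × (J → ℝ) → Set.Icc a u → ℝ, Measurable g ∧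
      (fun ω (r : Set.Icc a u) => Y r ω) =ᵐ[P]
        fun ω => g (lagVector d Y (s + 1) ω, fun i : J => v i ω) := by
  choose g hg hgY using fun r : Set.Icc a u =>
    h.exists_eq_comp_lagVector_noise hm hs hu hJ (ha.trans r.2.1) r.2.2
  exact ⟨fun p r => g r p, measurable_pi_lambda _ hg,
    (ae_all_iff.2 hgY).mono fun _ => funext⟩

lemma indep_noise [IsProbabilityMeasure P] (h : IsNonlinearAR P d T ν m Y v) (hm : Measurable m)
    {s : ℤ} (hs : s ≤ T) {J : Finset (Set.Icc (1 : ℤ) T)} (hJ : ∀ i ∈ J, s < i) :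
    Indep (sigmaField Y (1 - d) s)
      (MeasurableSpace.comap (fun ω (i : J) => v i ω) inferInstance) P := by
  obtain ⟨g, hg, hgY⟩ := h.exists_path_eq_comp_lagVector_noise hm le_rfl hs (J := Jᶜ) (a := 1 - d)
    (fun i _ hi => Finset.mem_compl.2 fun hiJ => (hJ i hiJ).not_ge hi) (by omega)
  rw [zero_add] at hgY
  have noise_indep := h.iIndepFun_v.indepFun_finset Jᶜ J disjoint_compl_left
    fun i => h.measurable_v i i.2
  have init_indep := h.indepFun_init.comp measurable_id
    (ψ := fun w => (fun i : (Jᶜ : Finset (Set.Icc (1 : ℤ) T)) => w i, fun i : J => w i))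
    (by fun_prop)
  have past_indep := indepFun_prodMk_left_of_indepFun_prodMk_right
    (h.measurable_lagVector_succ le_rfl (by omega)) (h.measurable_noise Jᶜ) (h.measurable_noise J)
    init_indep noise_indep
  rw [sigmaField_eq_comap]
  exact (past_indep.comp hg measurable_id).congr hgY.symm .rfl

lemma lagVector_succ (h : IsNonlinearAR P d T ν m Y v) {s : ℤ} (hs : 0 ≤ s) (hsT : s + 1 ≤ T) :
    lagVector d Y (s + 1 + 1) =ᵐ[P] fun ω =>
      push (lagVector d Y (s + 1) ω) (m (lagVector d Y (s + 1) ω) + v (s + 1) ω) := by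
  filter_upwards [h.recursion (s + 1) ⟨by omega, hsT⟩] with ω hω
  rw [← hω]
  ext i
  cases hi : i.castSucc using Fin.cases with
  | zero =>
    have : (i : ℕ) = 0 := congrArg Fin.val hi
    simp only [lagVector, push, hi, Fin.cons_zero, this]
    congr
    omega
  | succ j =>
    have : (i : ℕ) = j + 1 := congrArg Fin.val hi
    simp only [lagVector, push, hi, Fin.cons_succ, this]
    congr 1
    push_cast
    ring

variable [IsProbabilityMeasure P]

/-- The Markov property: restricting `P` to an event of the past stands in for conditioning. -/
lemma map_restrict_lagVector_succ (h : IsNonlinearAR P d T ν m Y v) (hm : Measurable m) {s : ℤ}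
    (hs : 0 ≤ s) (hsT : s + 1 ≤ T) {A : Set Ω} (hA : MeasurableSet[sigmaField Y (1 - d) s] A) :
    (P.restrict A).map (lagVector d Y (s + 1 + 1)) =
      arKernel m (gaussianReal 0 1) ∘ₘ (P.restrict A).map (lagVector d Y (s + 1)) := by
  have hs1 : s + 1 ∈ Set.Icc (1 : ℤ) T := ⟨by omega, hsT⟩
  have hX := h.measurable_lagVector_succ hs (by omega)
  have hv := h.measurable_v _ hs1
  have indep : Indep (sigmaField Y (1 - d) s)
      (MeasurableSpace.comap (v (s + 1)) inferInstance) P := by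
    let J : Finset (Set.Icc (1 : ℤ) T) := {⟨s + 1, hs1⟩}
    refine indep_of_indep_of_le_right (h.indep_noise hm (by omega) (J := J) (by simp [J])) ?_
    exact MeasurableSpace.comap_le_comap_pi (g := fun (i : J) => v i)
      ⟨_, Finset.mem_singleton_self _⟩
  rw [arKernel, recursionKernel_comp_measure (measurable_push_add hm), ← h.law_v _ hs1,
    ← map_restrict_prodMk_of_indep (h.sigmaField_le le_rfl (by omega)) (measurable_lagVector hs) hv
      indep hA, Measure.map_map (measurable_push_add hm) (hX.prodMk hv)]
  exact Measure.map_congr (ae_restrict_of_ae (h.lagVector_succ hs hsT))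

lemma map_restrict_lagVector_add (h : IsNonlinearAR P d T ν m Y v) (hm : Measurable m) {s : ℤ}
    (hs : 0 ≤ s) (n : ℕ) (hn : s + n ≤ T) {A : Set Ω}
    (hA : MeasurableSet[sigmaField Y (1 - d) s] A) :
    (P.restrict A).map (lagVector d Y (s + n + 1)) =
      (arKernel m (gaussianReal 0 1) ^ n) ∘ₘ (P.restrict A).map (lagVector d Y (s + 1)) := by
  induction n with
  | zero =>
    rw [Nat.cast_zero, add_zero, pow_zero]
    exact Measure.id_comp.symm
  | succ n ih =>
    push_cast at hn ⊢
    rw [← add_assoc, h.map_restrict_lagVector_succ hm (by omega) (by omega)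
      (sigmaField_mono le_rfl (by omega) A hA), ih (by omega), Measure.comp_assoc, pow_succ']
    rfl

lemma map_lagVector (h : IsNonlinearAR P d T ν m Y v) (hm : Measurable m) (n : ℕ) (hn : n ≤ T) :
    P.map (lagVector d Y (n + 1)) = (arKernel m (gaussianReal 0 1) ^ n) ∘ₘ ν := by
  have := h.map_restrict_lagVector_add hm le_rfl n (by simpa using hn) MeasurableSet.univ
  simpa only [Measure.restrict_univ, zero_add, h.law_init] using this

/-- By the Markov property, the conditional mean given the past of a function of the future is a
function of the present state. -/
lemma exists_setIntegral_eq_setIntegral_lagVector (h : IsNonlinearAR P d T ν m Y v)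
    (hm : Measurable m) {s : ℤ} (hs : 0 ≤ s) (hsT : s ≤ T) {a : ℤ} (ha : s + 1 - d ≤ a) {f : Ω → ℝ}
    (hf : @IsTestFunction Ω (sigmaField Y a T) f) :
    ∃ g : (Fin d → ℝ) → ℝ, IsTestFunction g ∧ ∀ A, MeasurableSet[sigmaField Y (1 - d) s] A →
      ∫ ω in A, f ω ∂P = ∫ ω in A, g (lagVector d Y (s + 1) ω) ∂P := by
  let J : Finset (Set.Icc (1 : ℤ) T) := {i | s < i}
  rw [sigmaField_eq_comap] at hf
  obtain ⟨φ, hφ, rfl⟩ := exists_isTestFunction_comp hf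
  obtain ⟨G, hG, hGY⟩ := h.exists_path_eq_comp_lagVector_noise hm hs le_rfl (J := J)
    (fun i hi _ => (Finset.mem_filter_univ i).2 hi) ha
  have hnoise := h.measurable_noise J
  have indep := h.indep_noise hm hsT (J := J) fun i hi => (Finset.mem_filter_univ i).1 hi
  have := Measure.isProbabilityMeasure_map (μ := P) hnoise.aemeasurable
  have hφG : IsTestFunction (φ ∘ G) := ⟨hφ.measurable.comp hG, fun p => hφ.abs_le_one _⟩
  refine ⟨_, hφG.integral_prod_right (P.map fun ω (i : J) => v i ω), fun A hA => ?_⟩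
  rw [← setIntegral_prodMk_of_indep (h.sigmaField_le le_rfl hsT) (measurable_lagVector hs) hnoise
    indep hA hφG]
  exact integral_congr_ae (ae_restrict_of_ae (hGY.mono fun ω => congrArg φ))

end IsNonlinearAR

section BetaCoefficient

variable {Ω : Type*} {𝒜 ℬ : MeasurableSpace Ω}

lemma IsFinitePartition.isTestFunction_sum_indicator {n : ℕ} {B : Fin n → Set Ω}
    (hB : IsFinitePartition ℬ B) {σ : Fin n → ℝ} (hσ : ∀ j, |σ j| ≤ 1) :
    @IsTestFunction Ω ℬ fun ω => ∑ j, (B j).indicator (fun _ => σ j) ω where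
  measurable := Finset.measurable_fun_sum _ fun j _ =>
    measurable_const.indicator (hB.measurableSet j)
  abs_le_one ω := by
    obtain ⟨j, hj⟩ := Set.mem_iUnion.1 (hB.iUnion_eq ▸ Set.mem_univ ω)
    rw [Finset.sum_eq_single j (fun i _ hij => Set.indicator_of_notMem
      (fun hi => Set.disjoint_left.1 (hB.disjoint i j hij) hi hj) _) (by simp),
      Set.indicator_of_mem hj]
    exact hσ j

variable [mΩ : MeasurableSpace Ω] {P : Measure Ω}

lemma betaCoeff_le_ofReal {b : ℝ} (h : ∀ (n k : ℕ) (A : Fin n → Set Ω) (B : Fin k → Set Ω),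
    IsFinitePartition 𝒜 A → IsFinitePartition ℬ B →
      ∑ i, ∑ j, |P.real (A i ∩ B j) - P.real (A i) * P.real (B j)| ≤ 2 * b) :
    betaCoeff P 𝒜 ℬ ≤ ENNReal.ofReal b := by
  rw [betaCoeff, ENNReal.inv_mul_le_iff two_ne_zero ENNReal.ofNat_ne_top,
    ← ENNReal.ofReal_ofNat 2, ← ENNReal.ofReal_mul zero_le_two]
  exact iSup₂_le fun n k => iSup₂_le fun A B => iSup₂_le fun hA hB =>
    ENNReal.ofReal_le_ofReal (h n k A B hA hB)

variable [IsProbabilityMeasure P]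

lemma IsFinitePartition.sum_abs_eq_setIntegral_sub (hℬ : ℬ ≤ mΩ) {n : ℕ} {B : Fin n → Set Ω}
    (hB : IsFinitePartition ℬ B) (A : Set Ω) : ∃ h : Ω → ℝ, @IsTestFunction Ω ℬ h ∧
      ∑ j, |P.real (A ∩ B j) - P.real A * P.real (B j)| =
        ∫ ω in A, h ω ∂P - P.real A * ∫ ω, h ω ∂P := by
  let σ (j : Fin n) : ℝ := SignType.sign (P.real (A ∩ B j) - P.real A * P.real (B j))
  have integral_eq (D : Set Ω) : ∫ ω in D, ∑ j, (B j).indicator (fun _ => σ j) ω ∂P =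
      ∑ j, σ j * P.real (D ∩ B j) := by
    have hBm (j : Fin n) : MeasurableSet (B j) := hℬ _ (hB.measurableSet j)
    rw [integral_finsetSum _ fun j _ => (integrable_const _).indicator (hBm j)]
    refine Finset.sum_congr rfl fun j _ => ?_
    rw [integral_indicator_const _ (hBm j), measureReal_restrict_apply (hBm j), smul_eq_mul,
      mul_comm, Set.inter_comm]
  refine ⟨_, hB.isTestFunction_sum_indicator (σ := σ) fun j => ?_, ?_⟩
  · rcases SignType.trichotomy (SignType.sign (P.real (A ∩ B j) - P.real A * P.real (B j)))
      with h | h | h <;> simp [σ, h]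
  · rw [integral_eq, ← setIntegral_univ, integral_eq, Finset.mul_sum, ← Finset.sum_sub_distrib]
    refine Finset.sum_congr rfl fun j _ => ?_
    rw [Set.univ_inter, ← sign_mul_self]
    ring

variable {E : Type*} [MeasurableSpace E] {Z : Ω → E} {U : E → ℝ≥0} {ε M : ℝ≥0}

lemma WeightedOscLE.setIntegral_sub_le {g : E → ℝ} (h : WeightedOscLE U ε g) (hg : IsTestFunction g)
    (hZ : Measurable Z) (hU : Measurable U) (hM : ∫⁻ x, U x ∂P.map Z ≤ M) (A : Set Ω) :
    ∫ ω in A, g (Z ω) ∂P - P.real A * ∫ ω, g (Z ω) ∂P ≤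
      ∫ ω in A, ε * ((U (Z ω) : ℝ) + M) ∂P := by
  have := Measure.isProbabilityMeasure_map (μ := P) hZ.aemeasurable
  have hUi : Integrable (fun ω => (U (Z ω) : ℝ)) P :=
    (integrable_coe_of_lintegral_le hU hM).comp_measurable hZ
  have hgi : Integrable (fun ω => g (Z ω)) P := (hg.integrable _).comp_measurable hZ
  calc ∫ ω in A, g (Z ω) ∂P - P.real A * ∫ ω, g (Z ω) ∂P
      = ∫ ω in A, g (Z ω) - ∫ x, g x ∂P.map Z ∂P := by
        rw [integral_sub hgi.integrableOn (integrable_const _), setIntegral_const, smul_eq_mul,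
          integral_map hZ.aemeasurable hg.measurable.aestronglyMeasurable]
    _ ≤ ∫ ω in A, ε * ((U (Z ω) : ℝ) + M) ∂P :=
        setIntegral_mono (hgi.sub (integrable_const _)).integrableOn
          ((hUi.add (integrable_const _)).const_mul _).integrableOn
          fun ω => h.sub_integral_le hg hU hM (Z ω)

/-- If the conditional means given `𝒜` of the `ℬ`-measurable functions are functions of `Z`, then
their oscillations bound the mixing coefficient: the sum over the cells of a partition of `ℬ` is
the covariance with a `ℬ`-measurable combination of signs. -/
lemma betaCoeff_le_of_weightedOscLE (h𝒜 : 𝒜 ≤ mΩ) (hℬ : ℬ ≤ mΩ) (hZ : Measurable Z)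
    (hU : Measurable U) (hM : ∫⁻ x, U x ∂P.map Z ≤ M)
    (H : ∀ h : Ω → ℝ, @IsTestFunction Ω ℬ h → ∃ g : E → ℝ, IsTestFunction g ∧ WeightedOscLE U ε g ∧
      ∀ A, MeasurableSet[𝒜] A → ∫ ω in A, h ω ∂P = ∫ ω in A, g (Z ω) ∂P) :
    betaCoeff P 𝒜 ℬ ≤ ENNReal.ofReal (ε * M) := by
  have hUi : Integrable (fun ω => (U (Z ω) : ℝ)) P :=
    (integrable_coe_of_lintegral_le hU hM).comp_measurable hZ
  have bound_int : Integrable (fun ω => ε * ((U (Z ω) : ℝ) + M)) P :=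
    (hUi.add (integrable_const _)).const_mul _
  refine betaCoeff_le_ofReal fun n k A B hA hB => ?_
  have row_le (i : Fin n) : ∑ j, |P.real (A i ∩ B j) - P.real (A i) * P.real (B j)| ≤
      ∫ ω in A i, ε * ((U (Z ω) : ℝ) + M) ∂P := by
    obtain ⟨h, hh, sum_eq⟩ := hB.sum_abs_eq_setIntegral_sub (P := P) hℬ (A i)
    obtain ⟨g, hg, hosc, hgA⟩ := H h hh
    rw [sum_eq, hgA _ (hA.measurableSet i), ← setIntegral_univ (f := h), hgA _ .univ,
      setIntegral_univ]
    exact hosc.setIntegral_sub_le hg hZ hU hM _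
  calc ∑ i, ∑ j, |P.real (A i ∩ B j) - P.real (A i) * P.real (B j)|
      ≤ ∑ i, ∫ ω in A i, ε * ((U (Z ω) : ℝ) + M) ∂P := Finset.sum_le_sum fun i _ => row_le i
    _ = ∫ ω, ε * ((U (Z ω) : ℝ) + M) ∂P := by
        rw [← integral_iUnion_fintype (fun i => h𝒜 _ (hA.measurableSet i))
          (fun i j hij => hA.disjoint i j hij)
          fun i => bound_int.integrableOn, hA.iUnion_eq, setIntegral_univ]
    _ = ε * (∫ x, (U x : ℝ) ∂P.map Z + M) := by
        rw [integral_const_mul, integral_add hUi (integrable_const _),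
          integral_map hZ.aemeasurable hU.coe_nnreal_real.aestronglyMeasurable]
        simp
    _ ≤ ε * (M + M) := by
        gcongr
        exact integral_coe_le_of_lintegral_coe_le hM
    _ = 2 * (ε * M) := by ring

end BetaCoefficient

lemma IsNonlinearAR.betaMixing_le {Ω : Type*} [MeasurableSpace Ω] {P : Measure Ω}
    [IsProbabilityMeasure P] {d T : ℕ} {ν : Measure (Fin d → ℝ)} {m : (Fin d → ℝ) → ℝ}
    {Y v : ℤ → Ω → ℝ} (h : IsNonlinearAR P d T ν m Y v) (hd : d ≠ 0) (hm : Measurable m)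
    {U : (Fin d → ℝ) → ℝ≥0} (hU : Measurable U) {ε M : ℝ≥0}
    (hM : ∀ n : ℕ, ∫⁻ x, U x ∂((arKernel m (gaussianReal 0 1) ^ n) ∘ₘ ν) ≤ M) {t : ℕ}
    (hosc : ∀ g : (Fin d → ℝ) → ℝ, IsTestFunction g →
      WeightedOscLE U ε (markovOperator (arKernel m (gaussianReal 0 1) ^ t) g)) :
    betaMixing P Y T t ≤ ENNReal.ofReal (ε * M) := by
  refine iSup₂_le fun k hk => ?_
  lift k to ℕ using by omega
  have := isMarkovKernel_arKernel hm (gaussianReal 0 1)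
  have past_le : sigmaField Y 1 k ≤ sigmaField Y (1 - d) k := sigmaField_mono (by omega) le_rfl
  have hX := h.measurable_lagVector_succ (s := k) (by omega) (by omega)
  refine betaCoeff_le_of_weightedOscLE (past_le.trans (h.sigmaField_le le_rfl (by omega)))
    (h.sigmaField_le (by omega) le_rfl) hX hU
    ((h.map_lagVector hm k (by omega)).symm ▸ hM k) fun f hf => ?_
  obtain ⟨g, hg, hfg⟩ := h.exists_setIntegral_eq_setIntegral_lagVector hm (s := k + t) (by omega)
    hk.2 (by omega) hf
  refine ⟨_, hg.markovOperator _, hosc g hg, fun A hA => ?_⟩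
  replace hA := past_le A hA
  have hX' := h.measurable_lagVector_succ (s := k + t) (by omega) hk.2
  calc ∫ ω in A, f ω ∂P = ∫ ω in A, g (lagVector d Y (k + t + 1) ω) ∂P :=
        hfg A (sigmaField_mono le_rfl (by omega) A hA)
    _ = ∫ x, g x ∂(P.restrict A).map (lagVector d Y (k + t + 1)) :=
        (integral_map hX'.aemeasurable hg.measurable.aestronglyMeasurable).symm
    _ = ∫ x, markovOperator (arKernel m (gaussianReal 0 1) ^ t) g x
          ∂(P.restrict A).map (lagVector d Y (k + 1)) := by
        rw [h.map_restrict_lagVector_add hm (by omega) t hk.2 hA, integral_comp_measure hg]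
    _ = ∫ ω in A, markovOperator (arKernel m (gaussianReal 0 1) ^ t) g
          (lagVector d Y (k + 1) ω) ∂P :=
        integral_map hX.aemeasurable (hg.markovOperator _).measurable.aestronglyMeasurable

lemma pow_div_le_inv_mul_exp {ρ : ℝ} (hρ : 0 < ρ) (hρ1 : ρ ≤ 1) {d : ℕ} (hd : d ≠ 0) (t : ℕ) :
    ρ ^ (t / d) ≤ ρ⁻¹ * Real.exp (-(-Real.log ρ / d) * t) := by
  have hd' : (0 : ℝ) < d := by positivity
  have div_le : (t : ℝ) / d ≤ (t / d : ℕ) + 1 := by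
    rw [div_le_iff₀' hd']
    exact_mod_cast (Nat.lt_mul_div_succ t (Nat.pos_of_ne_zero hd)).le
  calc ρ ^ (t / d) = ρ⁻¹ * Real.exp (((t / d : ℕ) + 1) * Real.log ρ) := by
        rw [add_one_mul, Real.exp_add, Real.exp_nat_mul, Real.exp_log hρ]
        field_simp
    _ ≤ ρ⁻¹ * Real.exp (t / d * Real.log ρ) := by
        gcongr ρ⁻¹ * Real.exp ?_
        exact mul_le_mul_of_nonpos_right div_le (Real.log_nonpos hρ.le hρ1)
    _ = ρ⁻¹ * Real.exp (-(-Real.log ρ / d) * t) := by ring_nf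

lemma lintegral_nnnorm_ne_top_of_integrable_sqrt {d : ℕ} {ν : Measure (Fin d → ℝ)}
    (hν : Integrable (fun x : Fin d → ℝ => Real.sqrt (∑ i, x i ^ 2)) ν) :
    ∫⁻ x, ‖x‖₊ ∂ν ≠ ∞ := by
  have : Integrable id ν := hν.mono' aestronglyMeasurable_id <| ae_of_all _ fun x =>
    (pi_norm_le_iff_of_nonneg (Real.sqrt_nonneg _)).2 fun i => Real.abs_le_sqrt <|
      Finset.single_le_sum (fun j _ => sq_nonneg (x j)) (Finset.mem_univ i)
  exact this.2.ne

end

theorem mainTheorem8 (d : ℕ) (hd : 1 ≤ d) (c : Fin (d + 1) → ℝ) (hc : ∀ i, 0 < c i)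
    (hc1 : ∑ i : Fin d, c i.succ < 1)
    (ν : Measure (Fin d → ℝ)) [IsProbabilityMeasure ν]
    (hν : Integrable (fun x : Fin d → ℝ => Real.sqrt (∑ i, x i ^ 2)) ν) :
    ∃ C C' : ℝ, 0 < C ∧ 0 < C' ∧
      ∀ m ∈ regressionClass c, ∀ (T : ℕ) (Ω : Type*) [MeasurableSpace Ω] (P : Measure Ω)
        [IsProbabilityMeasure P] (Y v : ℤ → Ω → ℝ), IsNonlinearAR P d T ν m Y v →
        ∀ t : ℕ, 1 ≤ t → betaMixing P Y T t ≤ ENNReal.ofReal (C' * Real.exp (-C * t)) := by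
  have hd0 : d ≠ 0 := Nat.one_le_iff_ne_zero.1 hd
  lift c to Fin (d + 1) → NNReal using fun i => (hc i).le
  have sum_lt_one : ∑ i : Fin d, c i.succ < 1 := by
    beta_reduce at hc1
    exact_mod_cast hc1
  have gaussian_moment : ∫⁻ z, ‖z‖₊ ∂gaussianReal 0 1 ≠ ∞ :=
    ((memLp_id_gaussianReal (μ := 0) (v := 1) 1).integrable (by simp)).2.ne
  obtain ⟨U, ρ, M, hU, hU1, hρ, hρ1, H⟩ := exists_uniform_contraction hd0 sum_lt_one
    (locallyDominatesVolume_gaussianReal 0 one_ne_zero) gaussian_moment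
    (lintegral_nnnorm_ne_top_of_integrable_sqrt hν)
  refine ⟨-Real.log ρ / d, (ρ : ℝ)⁻¹ * (M + 1), ?_, by positivity, ?_⟩
  · exact div_pos (neg_pos.2 (Real.log_neg hρ hρ1)) (by positivity)
  intro m hm T Ω _ P _ Y v h t _
  have := isMarkovKernel_arKernel hm.1 (gaussianReal 0 1)
  obtain ⟨contracts, moment_le⟩ := H m hm
  refine (h.betaMixing_le hd0 hm.1 hU moment_le fun g hg =>
    contracts.of_pow hU1 hg t).trans (ENNReal.ofReal_le_ofReal ?_)
  calc ((ρ ^ (t / d) : NNReal) : ℝ) * M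
      ≤ (ρ : ℝ)⁻¹ * Real.exp (-(-Real.log ρ / d) * t) * (M + 1) := by
        push_cast
        gcongr
        · exact pow_div_le_inv_mul_exp hρ hρ1.le hd0 t
        · linarith
    _ = (ρ : ℝ)⁻¹ * (M + 1) * Real.exp (-(-Real.log ρ / d) * t) := by ring
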